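/- For all real numbers $\alpha,\beta>0$ let $X_{\alpha,\beta}$ be a Gamma random variable with shape parameter $\alpha$ and scale parameter $\beta$, i.e. with probability density $x\mapsto \dfrac{x^{\alpha-1}e^{-x/\beta}}{\Gamma(\alpha)\beta^{\alpha}}$ for $x>0$ (and $0$ for $x\le 0$). Then, for all $\alpha,\beta>0$, $$P\{X_{\alpha,\beta}\le E[X_{\alpha,\beta}]\}>\frac12,$$ and $$\inf_{\alpha,\beta>0}P\{X_{\alpha,\beta}\le E[X_{\alpha,\beta}]\}=\frac12 .$$ -/

import Mathlib

open MeasureTheory ProbabilityTheory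

/-- The Gamma distribution with shape `α` and scale `β`, that is, with density
`x ^ (α - 1) * exp (-x / β) / (Γ(α) * β ^ α)` on `x > 0`. Mathlib's `gammaMeasure` takes the
shape and the rate, and the rate is the inverse of the scale. -/
noncomputable def gammaScaleMeasure (α β : ℝ) : Measure ℝ :=
  gammaMeasure α β⁻¹

/-- The law is the one given by the usual shape-scale density. -/
theorem gammaScaleMeasure_eq (α β : ℝ) (hβ : 0 < β) :
    gammaScaleMeasure α β = (volume.restrict (Set.Ioi (0 : ℝ))).withDensity
      (fun x => ENNReal.ofReal
        (x ^ (α - 1) * Real.exp (-x / β) / (Real.Gamma α * β ^ α))) := by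
  rw [gammaScaleMeasure, gammaMeasure, ← withDensity_indicator measurableSet_Ioi]
  refine withDensity_congr_ae ?_
  have h0 : ∀ᵐ x : ℝ ∂volume, x ≠ 0 := by simp [ae_iff]
  filter_upwards [h0] with x hx
  rcases lt_or_gt_of_ne hx with h | h
  · rw [gammaPDF_of_neg h, Set.indicator_of_notMem (by simpa using h.le)]
  · rw [gammaPDF_of_nonneg h.le, Set.indicator_of_mem (by simpa using h)]
    congr 1
    rw [Real.inv_rpow hβ.le]
    have h1 : -(β⁻¹ * x) = -x / β := by ring
    rw [h1]
    ring

open Real Set Filter Topology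

/-! Centre the density at its mean `m`: `g t = f (m + t)` has first moment zero. By
`exists_crossing`, `g t - g (-t)` on `t > 0` passes once from negative to nonnegative, at some `c`,
so `(t - c) * (g t - g (-t))` has positive integral there. The `t` part integrates to zero, which
leaves more mass below the mean than above. For sharpness take shape `n + 1` and scale 1. At most
half the mass lies below the mode `n`, and the unit interval from mode to mean adds at most the
modal height, which is `O(1/√n)` by Stirling. -/

theorem mul_log_sub_log_le {x y : ℝ} (hx : 0 < x) (hxy : x ≤ y) (hy : y < 1) :
    y * (log (1 + x) - log (1 - x)) ≤ x * (log (1 + y) - log (1 - y)) := by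
  have hX := (hasSum_log_sub_log_of_abs_lt_one (x := x)
    (by rw [abs_of_pos hx]; linarith)).mul_left y
  have hY := (hasSum_log_sub_log_of_abs_lt_one (x := y)
    (by rw [abs_of_pos (hx.trans_le hxy)]; linarith)).mul_left x
  -- Termwise comparison: the odd series has nonnegative coefficients, so its quotient by `x` is
  -- increasing.
  refine hasSum_le (fun k => ?_) hX hY
  have hy0 : 0 < y := hx.trans_le hxy
  have h : x ^ (2 * k) ≤ y ^ (2 * k) := by gcongr
  have h2 : 0 ≤ 2 * (1 / (2 * (k : ℝ) + 1)) * (x * y) := by positivity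
  have h3 := mul_le_mul_of_nonneg_left h h2
  rw [pow_succ, pow_succ]
  linarith

theorem two_mul_le_log_sub_log {x : ℝ} (hx : 0 < x) (hx1 : x < 1) :
    2 * x ≤ log (1 + x) - log (1 - x) := by
  have hX := hasSum_log_sub_log_of_abs_lt_one (x := x) (by rw [abs_of_pos hx]; linarith)
  have h := le_hasSum hX 0 (fun k _ => by positivity)
  simpa using h

theorem log_sub_log_le {x : ℝ} (hx : 0 < x) (hx1 : x < 1) :
    log (1 + x) - log (1 - x) ≤ 2 * x / (1 - x) := by
  have h1 : 0 < 1 - x := by linarith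
  rw [← log_div (by linarith) h1.ne']
  refine (log_le_sub_one_of_pos (by positivity)).trans (le_of_eq ?_)
  field_simp
  ring

/-- The logarithmic ratio of the Gamma density at points symmetric about the mean changes sign
once. -/
theorem exists_crossing {a : ℝ} (ha : 0 < a) : ∃ c : ℝ, 0 < c ∧ c ≤ 1 ∧
    (∀ x, 0 < x → x < c → (a - 1) * (log (1 + x) - log (1 - x)) < 2 * a * x) ∧
    (∀ x, c < x → x < 1 → 2 * a * x ≤ (a - 1) * (log (1 + x) - log (1 - x))) := by
  set S : Set ℝ := {x | 0 < x ∧ x < 1 ∧ (a - 1) * (log (1 + x) - log (1 - x)) < 2 * a * x}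
    with hS
  have hbdd : BddAbove S := ⟨1, fun x hx => hx.2.1.le⟩
  have hlow : ∀ x y, 0 < x → x < y → y ∈ S → x ∈ S := by
    rintro x y hx hxy ⟨hy0, hy1, hy⟩
    refine ⟨hx, hxy.trans hy1, ?_⟩
    rcases le_or_gt a 1 with h1 | h1
    · have := two_mul_le_log_sub_log hx (hxy.trans hy1)
      have h3 : (a - 1) * (log (1 + x) - log (1 - x)) ≤ 0 :=
        mul_nonpos_of_nonpos_of_nonneg (by linarith) (by linarith)
      have : 0 < 2 * a * x := by positivity
      linarith
    · have h2 := mul_le_mul_of_nonneg_left (mul_log_sub_log_le hx hxy.le hy1)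
        (by linarith : 0 ≤ a - 1)
      have h3 := mul_lt_mul_of_pos_left hy hx
      refine lt_of_mul_lt_mul_left ?_ hy0.le
      linarith
  obtain ⟨x₀, hx₀⟩ : S.Nonempty := by
    rcases le_or_gt a 1 with h1 | h1
    · refine ⟨1 / 2, by norm_num, by norm_num, ?_⟩
      have := two_mul_le_log_sub_log (x := 1 / 2) (by norm_num) (by norm_num)
      have h3 : (a - 1) * (log (1 + 1 / 2) - log (1 - 1 / 2)) ≤ 0 :=
        mul_nonpos_of_nonpos_of_nonneg (by linarith) (by linarith)
      linarith
    · have hx0 : 0 < 1 / (2 * a) := by positivity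
      have hx1 : 1 / (2 * a) < 1 := by rw [div_lt_one (by positivity)]; linarith
      -- Here the right side is 1, and `log_sub_log_le` bounds the left by `(2a - 2) / (2a - 1) <
      -- 1`.
      refine ⟨1 / (2 * a), hx0, hx1, ?_⟩
      have h2 := mul_le_mul_of_nonneg_left (log_sub_log_le hx0 hx1) (by linarith : 0 ≤ a - 1)
      refine h2.trans_lt ?_
      have h4 : 0 < 2 * a - 1 := by linarith
      have h5 : (a - 1) * (2 * (1 / (2 * a)) / (1 - 1 / (2 * a))) = (2 * a - 2) / (2 * a - 1) := by
        field_simp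
      have h6 : 2 * a * (1 / (2 * a)) = 1 := by field_simp
      rw [h5, h6, div_lt_one h4]
      linarith
  -- `S` is an initial segment of `(0, 1)`. For `a ≤ 1` it is all of it, so `c = 1` and the last
  -- claim is vacuous.
  refine ⟨sSup S, hx₀.1.trans_le (le_csSup hbdd hx₀), csSup_le ⟨x₀, hx₀⟩ fun x hx => hx.2.1.le,
    fun x hx hxc => ?_, fun x hcx hx1 => ?_⟩
  · obtain ⟨y, hy, hxy⟩ := exists_lt_of_lt_csSup ⟨x₀, hx₀⟩ hxc
    exact (hlow x y hx hxy hy).2.2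
  · by_contra! h
    have hx : 0 < x := (hx₀.1.trans_le (le_csSup hbdd hx₀)).trans hcx
    exact absurd (le_csSup hbdd (⟨hx, hx1, h⟩ : x ∈ S)) (not_le.2 hcx)

/-- If `g` has first moment zero and `g t - g (-t)` changes sign once, from negative to nonnegative,
then `g` has more mass on the left of zero than on the right. -/
theorem setIntegral_Ioi_lt_setIntegral_Iic {g : ℝ → ℝ} (hg : Integrable g)
    (hxg : Integrable fun t => t * g t) (h0 : ∫ t, t * g t = 0) {c : ℝ} (hc : 0 < c)
    (hlt : ∀ t, 0 < t → t < c → g t < g (-t)) (hge : ∀ᵐ t, c < t → g (-t) ≤ g t) :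
    ∫ t in Ioi 0, g t < ∫ t in Iic 0, g t := by
  have hgn : Integrable fun t => g (-t) := hg.comp_neg
  have hxgn : Integrable fun t => -t * g (-t) := hxg.comp_neg
  have e1 : ∫ t in Ioi (0 : ℝ), g (-t) = ∫ t in Iic 0, g t := by
    simp
  have e2 : ∫ t in Ioi (0 : ℝ), -t * g (-t) = ∫ t in Iic 0, t * g t := by
    simpa using integral_comp_neg_Ioi 0 fun t => t * g t
  have e3 : (∫ t in Iic (0 : ℝ), t * g t) + ∫ t in Ioi 0, t * g t = 0 := by
    rw [intervalIntegral.integral_Iic_add_Ioi hxg.integrableOn hxg.integrableOn, h0]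
  have hA : Integrable fun t => t * g t + -t * g (-t) := hxg.add hxgn
  have hB : Integrable fun t => c * (g t - g (-t)) := (hg.sub hgn).const_mul c
  have hF : Integrable fun t => (t * g t + -t * g (-t)) - c * (g t - g (-t)) :=
    hA.sub hB
  -- The integrand is `(t - c) * (g t - g (-t))`, strictly positive on `(0, c)`.
  have hpos : 0 < ∫ t in Ioi (0 : ℝ), ((t * g t + -t * g (-t)) - c * (g t - g (-t))) := by
    rw [setIntegral_pos_iff_support_of_nonneg_ae _ hF.integrableOn]
    · refine lt_of_lt_of_le ?_ (measure_mono (s := Ioo 0 c) fun t ht => ⟨?_, ht.1⟩)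
      · simp [hc]
      · have := mul_pos (sub_pos.2 ht.2) (sub_pos.2 (hlt t ht.1 ht.2))
        rw [Function.mem_support]
        exact ne_of_gt (by linarith)
    · filter_upwards [ae_restrict_mem measurableSet_Ioi, ae_restrict_of_ae hge] with t ht h
      rw [Pi.zero_apply]
      rcases lt_trichotomy t c with h1 | h1 | h1
      · have := mul_pos (sub_pos.2 h1) (sub_pos.2 (hlt t ht h1))
        linarith
      · rw [h1]
        linarith
      · have := mul_nonneg (sub_nonneg.2 h1.le) (sub_nonneg.2 (h h1))
        linarith
  rw [integral_sub hA.integrableOn hB.integrableOn,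
    integral_add hxg.integrableOn hxgn.integrableOn, integral_const_mul,
    integral_sub hg.integrableOn hgn.integrableOn, e1, e2] at hpos
  have : 0 < c * ((∫ t in Iic (0 : ℝ), g t) - ∫ t in Ioi 0, g t) := by linarith
  linarith [(mul_pos_iff_of_pos_left hc).1 this]

theorem setIntegral_Ioi_comp_add_left (f : ℝ → ℝ) (m : ℝ) :
    ∫ t in Ioi 0, f (m + t) = ∫ x in Ioi m, f x := by
  have h := (measurePreserving_add_left volume m).setIntegral_preimage_emb
    (measurableEmbedding_addLeft m) f (Ioi m)
  simpa using h

theorem setIntegral_Iic_comp_add_left (f : ℝ → ℝ) (m : ℝ) :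
    ∫ t in Iic 0, f (m + t) = ∫ x in Iic m, f x := by
  have h := (measurePreserving_add_left volume m).setIntegral_preimage_emb
    (measurableEmbedding_addLeft m) f (Iic m)
  simpa using h

/-! ### Moments of the Gamma density -/

section Gamma

variable {a r : ℝ}

theorem integrable_gammaPDFReal (ha : 0 < a) (hr : 0 < r) : Integrable (gammaPDFReal a r) := by
  refine ⟨by fun_prop, ?_⟩
  rw [hasFiniteIntegral_iff_ofReal (ae_of_all _ (gammaPDFReal_nonneg ha hr))]
  have := lintegral_gammaPDF_eq_one ha hr
  simp only [gammaPDF] at this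
  simp [this]

theorem integral_gammaPDFReal (ha : 0 < a) (hr : 0 < r) : ∫ x, gammaPDFReal a r x = 1 := by
  rw [integral_eq_lintegral_of_nonneg_ae (ae_of_all _ (gammaPDFReal_nonneg ha hr)) (by fun_prop)]
  have := lintegral_gammaPDF_eq_one ha hr
  simp only [gammaPDF] at this
  simp [this]

/-- Size-biasing raises the shape by one, so the mean follows from normalisation. -/
theorem mul_gammaPDFReal (ha : 0 < a) (hr : 0 < r) (x : ℝ) :
    x * gammaPDFReal a r x = a / r * gammaPDFReal (a + 1) r x := by
  unfold gammaPDFReal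
  split_ifs with hx
  · rcases hx.eq_or_lt with rfl | hx
    · simp [ha.ne']
    · have hG := (Gamma_pos_of_pos ha).ne'
      have h1 : x ^ (a + 1 - 1) = x ^ (a - 1) * x := by
        rw [← rpow_add_one hx.ne']; ring_nf
      rw [h1, rpow_add_one hr.ne', Gamma_add_one ha.ne']
      field_simp
  · simp

theorem integrable_mul_gammaPDFReal (ha : 0 < a) (hr : 0 < r) :
    Integrable fun x => x * gammaPDFReal a r x := by
  simp_rw [mul_gammaPDFReal ha hr]
  exact (integrable_gammaPDFReal (by linarith) hr).const_mul _

theorem integral_mul_gammaPDFReal (ha : 0 < a) (hr : 0 < r) :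
    ∫ x, x * gammaPDFReal a r x = a / r := by
  simp_rw [mul_gammaPDFReal ha hr]
  rw [integral_const_mul, integral_gammaPDFReal (by linarith) hr, mul_one]

theorem toReal_gammaPDF (ha : 0 < a) (hr : 0 < r) (x : ℝ) :
    (gammaPDF a r x).toReal = gammaPDFReal a r x :=
  ENNReal.toReal_ofReal (gammaPDFReal_nonneg ha hr x)

theorem measurable_gammaPDF (a r : ℝ) : Measurable (gammaPDF a r) :=
  (measurable_gammaPDFReal a r).ennreal_ofReal

theorem integrable_id_gammaMeasure (ha : 0 < a) (hr : 0 < r) :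
    Integrable (fun x => x) (gammaMeasure a r) := by
  rw [gammaMeasure, integrable_withDensity_iff_integrable_smul' (measurable_gammaPDF a r)
    (ae_of_all _ fun _ => ENNReal.ofReal_lt_top)]
  simp_rw [toReal_gammaPDF ha hr, smul_eq_mul, mul_comm (gammaPDFReal a r _)]
  exact integrable_mul_gammaPDFReal ha hr

theorem integral_id_gammaMeasure (ha : 0 < a) (hr : 0 < r) :
    ∫ x, x ∂gammaMeasure a r = a / r := by
  rw [gammaMeasure, integral_withDensity_eq_integral_toReal_smul (measurable_gammaPDF a r)
    (ae_of_all _ fun _ => ENNReal.ofReal_lt_top)]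
  simp_rw [toReal_gammaPDF ha hr, smul_eq_mul, mul_comm (gammaPDFReal a r _)]
  exact integral_mul_gammaPDFReal ha hr

theorem gammaMeasure_real_Iic (ha : 0 < a) (hr : 0 < r) (x : ℝ) :
    (gammaMeasure a r).real (Iic x) = ∫ y in Iic x, gammaPDFReal a r y := by
  have := isProbabilityMeasure_gammaMeasure ha hr
  rw [← cdf_eq_real, cdf_gammaMeasure_eq_integral ha hr]

theorem setIntegral_Iic_add_Ioi_gammaPDFReal (ha : 0 < a) (hr : 0 < r) (m : ℝ) :
    (∫ y in Iic m, gammaPDFReal a r y) + ∫ y in Ioi m, gammaPDFReal a r y = 1 := by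
  have h := integrable_gammaPDFReal ha hr
  rw [intervalIntegral.integral_Iic_add_Ioi h.integrableOn h.integrableOn,
    integral_gammaPDFReal ha hr]

/-! ### Reflecting the density about its mean -/

theorem gammaPDFReal_eq_exp {x : ℝ} (hx : 0 < x) :
    gammaPDFReal a r x = r ^ a / Gamma a * exp ((a - 1) * log x - r * x) := by
  rw [gammaPDFReal, if_pos hx.le, rpow_def_of_pos hx, mul_assoc, ← exp_add]
  ring_nf

theorem gammaPDFReal_lt_iff (ha : 0 < a) (hr : 0 < r) {x y : ℝ} (hx : 0 < x) (hy : 0 < y) :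
    gammaPDFReal a r x < gammaPDFReal a r y ↔
      (a - 1) * log x - r * x < (a - 1) * log y - r * y := by
  have : 0 < r ^ a / Gamma a := div_pos (rpow_pos_of_pos hr a) (Gamma_pos_of_pos ha)
  rw [gammaPDFReal_eq_exp hx, gammaPDFReal_eq_exp hy, mul_lt_mul_iff_right₀ this, exp_lt_exp]

theorem gammaPDFReal_le_iff (ha : 0 < a) (hr : 0 < r) {x y : ℝ} (hx : 0 < x) (hy : 0 < y) :
    gammaPDFReal a r x ≤ gammaPDFReal a r y ↔
      (a - 1) * log x - r * x ≤ (a - 1) * log y - r * y := by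
  rw [← not_lt, gammaPDFReal_lt_iff ha hr hy hx, not_lt]

theorem log_add_sub_log_sub {m t : ℝ} (hm : 0 < m) (ht : 0 < t) (htm : t < m) :
    log (m + t) - log (m - t) = log (1 + t / m) - log (1 - t / m) := by
  have h1 : t / m < 1 := (div_lt_one hm).2 htm
  have h0 : 0 < t / m := by positivity
  have e1 : m + t = m * (1 + t / m) := by field_simp
  have e2 : m - t = m * (1 - t / m) := by field_simp
  rw [e1, e2, log_mul hm.ne' (by linarith), log_mul hm.ne' (by linarith)]
  ring

theorem half_lt_setIntegral_gammaPDFReal (ha : 0 < a) (hr : 0 < r) :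
    1 / 2 < ∫ y in Iic (a / r), gammaPDFReal a r y := by
  set m := a / r with hm
  have hm0 : 0 < m := by positivity
  have hrm : r * m = a := by rw [hm]; field_simp
  obtain ⟨c, hc0, hc1, hlt, hge⟩ := exists_crossing ha
  have hI := integrable_gammaPDFReal ha hr
  have hxI := integrable_mul_gammaPDFReal ha hr
  have hscale : ∀ t, 2 * a * (t / m) = 2 * r * t := fun t => by
    rw [← hrm]; field_simp
  have key : ∫ t in Ioi 0, gammaPDFReal a r (m + t) < ∫ t in Iic 0, gammaPDFReal a r (m + t) := by
    have hmul : (fun t => t * gammaPDFReal a r (m + t)) = fun t =>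
        (m + t) * gammaPDFReal a r (m + t) - m * gammaPDFReal a r (m + t) := by
      ext t; ring
    refine setIntegral_Ioi_lt_setIntegral_Iic (c := c * m) (hI.comp_add_left m) ?_ ?_
      (by positivity) ?_ ?_
    · rw [hmul]
      exact (hxI.comp_add_left m).sub ((hI.comp_add_left m).const_mul m)
    · rw [hmul, integral_sub (hxI.comp_add_left m) ((hI.comp_add_left m).const_mul m),
        integral_add_left_eq_self (fun x => x * gammaPDFReal a r x), integral_const_mul,
        integral_add_left_eq_self (fun x => gammaPDFReal a r x), integral_gammaPDFReal ha hr,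
        integral_mul_gammaPDFReal ha hr]
      ring
    · intro t ht htc
      have htm : t < m := htc.trans_le (by nlinarith)
      rw [← sub_eq_add_neg, gammaPDFReal_lt_iff ha hr (by linarith) (by linarith)]
      have := hlt (t / m) (by positivity) ((div_lt_iff₀ hm0).2 htc)
      rw [← log_add_sub_log_sub hm0 ht htm, hscale] at this
      linarith
    -- At `t = m` the reflected point is 0, where the logarithmic form fails; beyond it the
    -- reflected density vanishes.
    · have hne : ∀ᵐ t : ℝ, t ≠ m := by simp [ae_iff]
      filter_upwards [hne] with t htm hct
      have ht : 0 < t := lt_trans (by positivity) hct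
      rw [← sub_eq_add_neg]
      rcases lt_or_gt_of_ne htm with h | h
      · rw [gammaPDFReal_le_iff ha hr (by linarith) (by linarith)]
        have := hge (t / m) ((lt_div_iff₀ hm0).2 hct) ((div_lt_one hm0).2 h)
        rw [← log_add_sub_log_sub hm0 ht h, hscale] at this
        linarith
      · rw [gammaPDFReal, if_neg (by linarith)]
        exact gammaPDFReal_nonneg ha hr _
  rw [setIntegral_Ioi_comp_add_left, setIntegral_Iic_comp_add_left] at key
  linarith [setIntegral_Iic_add_Ioi_gammaPDFReal ha hr m]

/-! ### Sharpness: mode and Stirling bound -/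

/-- The Gamma law gives mass at most one half to the left of its mode. -/
theorem setIntegral_Iic_mode_gammaPDFReal_le {s : ℝ} (hs : 0 < s) :
    ∫ y in Iic s, gammaPDFReal (s + 1) 1 y ≤ 1 / 2 := by
  have hs1 : 0 < s + 1 := by linarith
  have hI := (integrable_gammaPDFReal hs1 one_pos).comp_add_left s
  have key : ∫ t in Ioi 0, gammaPDFReal (s + 1) 1 (s + -t) ≤
      ∫ t in Ioi 0, gammaPDFReal (s + 1) 1 (s + t) := by
    refine setIntegral_mono_on_ae hI.comp_neg.integrableOn hI.integrableOn measurableSet_Ioi ?_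
    have hne : ∀ᵐ t : ℝ, t ≠ s := by simp [ae_iff]
    filter_upwards [hne] with t hts ht
    have ht : 0 < t := ht
    rw [← sub_eq_add_neg]
    rcases lt_or_gt_of_ne hts with h | h
    · rw [gammaPDFReal_le_iff hs1 one_pos (by linarith) (by linarith)]
      -- About the mode the log ratio is `s * (log (1 + t/s) - log (1 - t/s)) - 2 * t ≥ 0`.
      have h2 := mul_le_mul_of_nonneg_left
        (two_mul_le_log_sub_log (x := t / s) (by positivity) ((div_lt_one hs).2 h)) hs.le
      rw [← log_add_sub_log_sub hs ht h] at h2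
      have h3 : s * (2 * (t / s)) = 2 * t := by field_simp
      linarith
    · rw [gammaPDFReal, if_neg (by linarith)]
      exact gammaPDFReal_nonneg hs1 one_pos _
  have e : ∫ t in Ioi (0 : ℝ), gammaPDFReal (s + 1) 1 (s + -t) =
      ∫ t in Iic 0, gammaPDFReal (s + 1) 1 (s + t) := by
    simpa using integral_comp_neg_Ioi 0 fun t => gammaPDFReal (s + 1) 1 (s + t)
  rw [e, setIntegral_Ioi_comp_add_left, setIntegral_Iic_comp_add_left] at key
  linarith [setIntegral_Iic_add_Ioi_gammaPDFReal hs1 one_pos s]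

theorem gammaPDFReal_le_mode {s : ℝ} (hs : 0 < s) {x : ℝ} (hx : 0 < x) :
    gammaPDFReal (s + 1) 1 x ≤ gammaPDFReal (s + 1) 1 s := by
  rw [gammaPDFReal_le_iff (by linarith) one_pos hx hs]
  have h := mul_le_mul_of_nonneg_left (log_le_sub_one_of_pos (div_pos hx hs)) hs.le
  rw [log_div hx.ne' hs.ne'] at h
  have : s * (x / s - 1) = x - s := by field_simp
  linarith

theorem gammaPDFReal_mode_le {n : ℕ} (hn : 0 < n) :
    gammaPDFReal (n + 1) 1 n ≤ 1 / √(2 * π * n) := by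
  have hn' : (0 : ℝ) < n := by exact_mod_cast hn
  rw [gammaPDFReal, if_pos hn'.le, one_rpow, Gamma_nat_eq_factorial, add_sub_cancel_right,
    rpow_natCast, one_mul]
  have h := Stirling.le_factorial_stirling n
  have e : ((n : ℝ) / exp 1) ^ n = (n : ℝ) ^ n * exp (-n) := by
    rw [div_pow, ← exp_nat_mul, mul_one, exp_neg, div_eq_mul_inv]
  rw [e] at h
  have h1 : 0 < √(2 * π * n) := by positivity
  have h2 : (0 : ℝ) < n.factorial := by positivity
  rw [le_div_iff₀ h1, mul_assoc, mul_assoc, one_div, inv_mul_le_iff₀ h2, mul_one]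
  linarith

theorem setIntegral_gammaPDFReal_le {n : ℕ} (hn : 0 < n) :
    ∫ y in Iic ((n : ℝ) + 1), gammaPDFReal (n + 1) 1 y ≤ 1 / 2 + 1 / √(2 * π * n) := by
  have hn' : (0 : ℝ) < n := by exact_mod_cast hn
  have hI := integrable_gammaPDFReal (by linarith : (0 : ℝ) < n + 1) one_pos
  have hle : (n : ℝ) ≤ n + 1 := by linarith
  rw [← Iic_union_Ioc_eq_Iic hle, setIntegral_union (Iic_disjoint_Ioc le_rfl) measurableSet_Ioc
    hI.integrableOn hI.integrableOn]
  refine add_le_add (setIntegral_Iic_mode_gammaPDFReal_le hn') ?_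
  have h : ∫ y in Ioc (n : ℝ) (n + 1), gammaPDFReal (n + 1) 1 y ≤
      ∫ _ in Ioc (n : ℝ) (n + 1), 1 / √(2 * π * n) :=
    setIntegral_mono_on hI.integrableOn (integrableOn_const (by simp)) measurableSet_Ioc fun x hx =>
      (gammaPDFReal_le_mode hn' (hn'.trans hx.1)).trans (gammaPDFReal_mode_le hn)
  simpa using h

end Gamma

theorem theorem1p1
    (Ω : ℝ → ℝ → Type*) [∀ α β : ℝ, MeasurableSpace (Ω α β)]
    (P : ∀ α β : ℝ, Measure (Ω α β)) (X : ∀ α β : ℝ, Ω α β → ℝ)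
    (hX : ∀ α β : ℝ, 0 < α → 0 < β → HasLaw (X α β) (gammaScaleMeasure α β) (P α β)) :
    (∀ α β : ℝ, 0 < α → 0 < β →
      Integrable (X α β) (P α β) ∧
      1 / 2 < (P α β).real {ω | X α β ω ≤ ∫ ω', X α β ω' ∂(P α β)}) ∧
    IsGLB {p : ℝ | ∃ α β : ℝ, 0 < α ∧ 0 < β ∧
      p = (P α β).real {ω | X α β ω ≤ ∫ ω', X α β ω' ∂(P α β)}} (1 / 2) := by
  have hmean : ∀ α β : ℝ, 0 < α → 0 < β → ∫ ω, X α β ω ∂(P α β) = α / β⁻¹ := by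
    intro α β hα hβ
    rw [(hX α β hα hβ).integral_eq]
    exact integral_id_gammaMeasure hα (inv_pos.2 hβ)
  have hprob : ∀ α β : ℝ, 0 < α → 0 < β →
      (P α β).real {ω | X α β ω ≤ ∫ ω', X α β ω' ∂(P α β)} =
        ∫ y in Iic (α / β⁻¹), gammaPDFReal α β⁻¹ y := by
    intro α β hα hβ
    rw [hmean α β hα hβ, (hX α β hα hβ).measureReal_eq (p := fun x => x ≤ α / β⁻¹)
      measurableSet_Iic]
    exact gammaMeasure_real_Iic hα (inv_pos.2 hβ) _
  refine ⟨fun α β hα hβ => ⟨?_, ?_⟩, ?_, fun b hb => ?_⟩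
  · have h := hX α β hα hβ
    have hi : Integrable (fun x => x) ((P α β).map (X α β)) := by
      rw [h.map_eq]
      exact integrable_id_gammaMeasure hα (inv_pos.2 hβ)
    exact hi.comp_aemeasurable h.aemeasurable
  · rw [hprob α β hα hβ]
    exact half_lt_setIntegral_gammaPDFReal hα (inv_pos.2 hβ)
  · rintro p ⟨α, β, hα, hβ, rfl⟩
    rw [hprob α β hα hβ]
    exact (half_lt_setIntegral_gammaPDFReal hα (inv_pos.2 hβ)).le
  · have hlim : Tendsto (fun n : ℕ => 1 / 2 + 1 / √(2 * π * n)) atTop (𝓝 (1 / 2)) := by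
      have h1 : Tendsto (fun n : ℕ => √(2 * π * n)) atTop atTop :=
        tendsto_sqrt_atTop.comp
          (tendsto_natCast_atTop_atTop.const_mul_atTop (by positivity : 0 < 2 * π))
      simpa using (h1.inv_tendsto_atTop).const_add (1 / 2 : ℝ)
    refine ge_of_tendsto hlim ?_
    filter_upwards [eventually_gt_atTop 0] with n hn
    have hn1 : (0 : ℝ) < n + 1 := by positivity
    have h := hb ⟨n + 1, 1, hn1, one_pos, rfl⟩
    rw [hprob _ _ hn1 one_pos, inv_one, div_one] at h
    exact h.trans (setIntegral_gammaPDFReal_le hn)
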